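/- Let $l_2$ be the real Hilbert space of square-summable real sequences, and let $l_2^\infty=\varinjlim l_2^n$ be the direct limit, in the category of topological spaces, of the sequence $l_2\subset l_2\times l_2\subset l_2\times l_2\times l_2\subset\cdots$, where $l_2^n$ carries the product topology and is identified with $l_2^n\times\{0\}\subset l_2^{n+1}$. Thus $l_2^\infty$ is the set of all sequences in $l_2$ that are eventually $0$, and a set $U\subset l_2^\infty$ is open if and only if $U\cap l_2^n$ is open in $l_2^n$ for every $n\ge 1$. A topological space $G$ is called rectifiable if there are a homeomorphism $\varphi$ of $G\times G$ onto itself and an element $e\in G$ such that $\pi_1\circ\varphi=\pi_1$, where $\pi_1$ is the projection to the first coordinate, and $\varphi(x,x)=(x,e)$ for every $x\in G$. A paratopological group is a group with a topology for which the multiplication $G\times G\to G$ is jointly continuous. A topological loop is a loop (a set with a binary operation that has a two-sided neutral element and in which all equations $ax=b$ and $ya=b$ are uniquely solvable) with a topology for which the multiplication and the left and right divisions are jointly continuous. Theorem. The space $l_2^\infty$ is not homeomorphic to any rectifiable space, and it is not homeomorphic to any paratopological group. Consequently, $l_2^\infty$ is not homeomorphic to any topological loop, nor to any topological group. -/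

import Mathlib

/-- The underlying set of the direct limit `X^∞` of the sequence
`X ⊂ X × X ⊂ X × X × X ⊂ ⋯` for a pointed space `(X, pt)`, where `X^n` is identified with
`X^n × {pt} ⊂ X^(n+1)`: the sequences in `X` which are eventually equal to `pt`. It is a
definition of its own (not a reducible subtype), so it carries no product topology. -/
def DirectLimitPower (X : Type*) (pt : X) : Type _ :=
  {x : ℕ → X // ∃ n : ℕ, ∀ i : ℕ, n ≤ i → x i = pt}

namespace DirectLimitPower

/-- The canonical map `X^(n+1) → X^∞`, `(v₀, …, vₙ) ↦ (v₀, …, vₙ, pt, pt, …)`. -/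
def incl {X : Type*} (pt : X) (n : ℕ) (v : Fin (n + 1) → X) : DirectLimitPower X pt :=
  ⟨fun i => if h : i < n + 1 then v ⟨i, h⟩ else pt,
    n + 1, fun _ hi => dif_neg (Nat.not_lt.mpr hi)⟩

/-- The direct limit topology: the finest topology on `X^∞` for which all the canonical maps
from the finite powers `X, X², X³, …` (with their product topologies) are continuous. -/
instance {X : Type*} [TopologicalSpace X] (pt : X) :
    TopologicalSpace (DirectLimitPower X pt) :=
  ⨆ n : ℕ, TopologicalSpace.coinduced (incl pt n) (inferInstance : TopologicalSpace (Fin (n + 1) → X))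

end DirectLimitPower

/-- `l₂^∞`, the direct limit of `l₂ ⊂ l₂ × l₂ ⊂ l₂ × l₂ × l₂ ⊂ ⋯`, where `l₂` is the real
separable Hilbert space of square-summable sequences, pointed at `0`. -/
abbrev L2Infty : Type :=
  DirectLimitPower (lp (fun _ : ℕ => ℝ) 2) 0

/-- A topological space `G` is rectifiable if there are a homeomorphism `φ` of `G × G` onto itself
and `e ∈ G` with `π₁ ∘ φ = π₁` and `φ (x, x) = (x, e)` for all `x`. -/
def IsRectifiable (G : Type*) [TopologicalSpace G] : Prop :=
  ∃ (φ : (G × G) ≃ₜ (G × G)) (e : G),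
    Prod.fst ∘ φ = Prod.fst ∧ ∀ x : G, φ (x, x) = (x, e)

/-- A topological loop structure on a topological space `G`: a multiplication with a two-sided
neutral element for which all equations `a * x = b` and `x * a = b` are uniquely solvable, such
that the multiplication and both divisions `ldiv a b = a \ b` and `rdiv b a = b / a` are jointly
continuous. No associativity is required. -/
structure TopologicalLoop (G : Type*) [TopologicalSpace G] where
  mul : G → G → G
  ldiv : G → G → G
  rdiv : G → G → G
  one : G
  one_mul : ∀ a, mul one a = a
  mul_one : ∀ a, mul a one = a
  mul_ldiv : ∀ a b, mul a (ldiv a b) = b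
  ldiv_mul : ∀ a b, ldiv a (mul a b) = b
  rdiv_mul : ∀ b a, mul (rdiv b a) a = b
  mul_rdiv : ∀ b a, rdiv (mul b a) a = b
  continuous_mul : Continuous fun z : G × G => mul z.1 z.2
  continuous_ldiv : Continuous fun z : G × G => ldiv z.1 z.2
  continuous_rdiv : Continuous fun z : G × G => rdiv z.1 z.2

/-!
The four statements have one common cause. On each of the spaces in question there are a point `e`
and a jointly continuous `p : G × G → G` such that `p (y, e) = y` and every `p (y, ·)` has a
continuous left inverse: the multiplication of a group or of a loop, and the second component of
`φ⁻¹` for a rectifiable space. No such `p` exists on `E^∞` when `E` is an infinite-dimensional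
Banach space (`DirectLimitPower.not_exists_continuous_right_unital`).

Write `E^(n+1)` for the range of `incl 0 n`. A union of closed sets `Zₙ` with `Zₙ ∩ E^(n+1) = ∅` is
closed in `E^∞`, because only finitely many of the `Zₙ` meet a given stage
(`DirectLimitPower.isClosed_iUnion_of_disjoint_range_incl`). The contradiction comes from such sets
`Zₙ`, none of which contains `e`, whose union nevertheless has `e` in its closure. They have the form
`Zₙ = {p (yₙₘ, xₙₘ) | m}`, where

* the `yₙₘ` differ from `e` only in the coordinate `0`, by less than `1 / (n + 1)`;
* for fixed `n` these coordinates are uniformly separated, and so are those of `p (yₙₘ, xₙₘ)`,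
  which makes `Zₙ` closed;
* for fixed `n` all `xₙₘ` lie in one stage and `xₙₘ → e` as `m → ∞`, so that `e` is in the closure
  of the union by the joint continuity of `p` at `(e, e)`;
* `p (yₙₘ, xₙₘ) ∉ E^(n+1)`.

For a single `y`, the point `e` is a limit, inside some stage `E^(k+1)`, of points `x` with
`p (y, x) ∉ E^(n+1)`: otherwise `p (y, ·)⁻¹` of the metrizable set `E^(n+1)` would contain a
neighbourhood of `e` in every stage, and a diagonal sequence leaving all the stages would converge to
`e` (`DirectLimitPower.exists_mem_closure_notMem_range_incl`). The stage `k` depends on `y`, but by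
the Baire category theorem one `k` serves a set of `y` that is dense in some ball, and a ball of `E`
contains an infinite uniformly separated set.
-/

open Set Filter Topology

/-! ### Topology of the direct limit -/

namespace DirectLimitPower

section Basic

variable {X : Type*} {pt : X}

/-- The first `n + 1` coordinates of a point of `X^∞`. -/
def restrict (n : ℕ) (x : DirectLimitPower X pt) : Fin (n + 1) → X := fun i => x.1 i

theorem incl_apply_of_lt {n i : ℕ} (v : Fin (n + 1) → X) (h : i < n + 1) :
    (incl pt n v).1 i = v ⟨i, h⟩ := dif_pos h

theorem incl_apply_of_le {n i : ℕ} (v : Fin (n + 1) → X) (h : n + 1 ≤ i) :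
    (incl pt n v).1 i = pt := dif_neg (Nat.not_lt.mpr h)

theorem incl_restrict {n : ℕ} {x : DirectLimitPower X pt} (h : ∀ i, n < i → x.1 i = pt) :
    incl pt n (restrict n x) = x := by
  refine Subtype.ext (funext fun i => ?_)
  rcases lt_or_ge i (n + 1) with hi | hi
  · exact incl_apply_of_lt _ hi
  · rw [incl_apply_of_le _ hi, h i hi]

theorem mem_range_incl_iff {n : ℕ} {x : DirectLimitPower X pt} :
    x ∈ range (incl pt n) ↔ ∀ i, n < i → x.1 i = pt := by
  constructor
  · rintro ⟨v, rfl⟩ i hi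
    exact incl_apply_of_le v hi
  · exact fun h => ⟨_, incl_restrict h⟩

theorem range_incl_mono {m n : ℕ} (h : m ≤ n) : range (incl pt m) ⊆ range (incl pt n) :=
  fun _ hx => mem_range_incl_iff.2 fun i hi => mem_range_incl_iff.1 hx i (h.trans_lt hi)

theorem exists_mem_range_incl (x : DirectLimitPower X pt) : ∃ n, x ∈ range (incl pt n) := by
  obtain ⟨n, hn⟩ := x.2
  exact ⟨n, mem_range_incl_iff.2 fun i hi => hn i hi.le⟩

variable [TopologicalSpace X]

theorem continuous_incl (n : ℕ) : Continuous (incl pt n) :=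
  continuous_iff_coinduced_le.2 (le_iSup (fun n : ℕ => TopologicalSpace.coinduced (incl pt n)
    (inferInstance : TopologicalSpace (Fin (n + 1) → X))) n)

theorem continuous_dom {Y : Type*} [TopologicalSpace Y] {f : DirectLimitPower X pt → Y}
    (h : ∀ n, Continuous (f ∘ incl pt n)) : Continuous f :=
  continuous_iSup_dom.2 fun n => continuous_coinduced_dom.2 (h n)

theorem isClosed_iff {s : Set (DirectLimitPower X pt)} :
    IsClosed s ↔ ∀ n, IsClosed (incl pt n ⁻¹' s) := by
  refine ⟨fun h n => h.preimage (continuous_incl n), fun h => ?_⟩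
  rw [← isOpen_compl_iff]
  refine isOpen_iSup_iff.2 fun n => isOpen_coinduced.2 ?_
  exact (h n).isOpen_compl

theorem continuous_apply (i : ℕ) : Continuous fun x : DirectLimitPower X pt => x.1 i := by
  refine continuous_dom fun n => ?_
  rcases lt_or_ge i (n + 1) with hi | hi
  · exact (_root_.continuous_apply (⟨i, hi⟩ : Fin (n + 1))).congr
      fun v => (incl_apply_of_lt v hi).symm
  · exact (continuous_const (y := pt)).congr fun v => (incl_apply_of_le v hi).symm

theorem continuous_restrict (n : ℕ) : Continuous (restrict (pt := pt) n) :=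
  continuous_pi fun i => continuous_apply (i : ℕ)

instance [T2Space X] : T2Space (DirectLimitPower X pt) :=
  T2Space.of_injective_continuous (f := fun x => x.1) Subtype.val_injective
    (continuous_pi continuous_apply)

theorem isClosed_iUnion_of_disjoint_range_incl {Z : ℕ → Set (DirectLimitPower X pt)}
    (hZ : ∀ n, IsClosed (Z n)) (hd : ∀ n, ∀ z ∈ Z n, z ∉ range (incl pt n)) :
    IsClosed (⋃ n, Z n) := by
  refine isClosed_iff.2 fun k => ?_
  have : incl pt k ⁻¹' (⋃ n, Z n) = ⋃ n ∈ Finset.range k, incl pt k ⁻¹' Z n := by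
    ext v
    simp only [mem_preimage, mem_iUnion, Finset.mem_range, exists_prop]
    refine exists_congr fun n => ⟨fun h => ⟨?_, h⟩, fun h => h.2⟩
    by_contra! hn
    exact hd n _ h (range_incl_mono hn (mem_range_self v))
  rw [this]
  exact isClosed_biUnion_finset fun n _ => (hZ n).preimage (continuous_incl k)

end Basic

/-! ### Escaping a stage by a small displacement -/

/-- If `T : X^∞ → X^∞` has a continuous left inverse, then within some stage there are points
arbitrarily close to `e` that `T` does not map into the stage `n`. Otherwise the first countability
of the stage `n` would produce a sequence that converges to `e` and leaves all the stages. -/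
theorem exists_mem_closure_notMem_range_incl {X : Type*} [MetricSpace X] {pt : X}
    [(𝓝[≠] pt).NeBot] {T S : DirectLimitPower X pt → DirectLimitPower X pt}
    (hT : Continuous T) (hS : Continuous S) (hST : ∀ x, S (T x) = x)
    {e : DirectLimitPower X pt} {N : ℕ} (he : e ∈ range (incl pt N)) (n : ℕ) :
    ∃ k, N ≤ k ∧ restrict k e ∈ closure {w | T (incl pt k w) ∉ range (incl pt n)} := by
  by_contra! hcon
  have hincl : ∀ k, N ≤ k → incl pt k (restrict k e) = e := fun k hk =>
    incl_restrict (mem_range_incl_iff.1 (range_incl_mono hk he))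
  have hTe : T e ∈ range (incl pt n) := by
    by_contra h
    refine hcon N le_rfl (subset_closure ?_)
    rwa [mem_ofPred_eq, hincl N le_rfl]
  -- The sequence `x` converges to `e` although its `j`-th term lies outside the stage `N + j`.
  have key : ∀ j : ℕ, ∃ x : DirectLimitPower X pt, x ∉ range (incl pt (N + j)) ∧
      T x ∈ range (incl pt n) ∧
      dist (restrict n (T x)) (restrict n (T e)) < 1 / ((j : ℝ) + 1) := by
    intro j
    set k := N + j + 1 with hk
    have hek : e.1 k = pt := mem_range_incl_iff.1 he k (by omega)
    let g : X → Fin (k + 1) → X := fun a => Function.update (restrict k e) (Fin.last k) a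
    have hg : Continuous g := continuous_const.update _ continuous_id
    have hgpt : g pt = restrict k e := by
      refine Function.update_eq_self_iff.2 ?_
      exact hek.symm
    have h1 : ∀ᶠ a in 𝓝 pt, T (incl pt k (g a)) ∈ range (incl pt n) := by
      have h := (hg.tendsto pt).eventually
        (p := fun w => w ∈ (closure {w | T (incl pt k w) ∉ range (incl pt n)})ᶜ)
        (by rw [hgpt]; exact isClosed_closure.isOpen_compl.mem_nhds (hcon k (by omega)))
      filter_upwards [h] with a ha
      by_contra hb
      exact ha (subset_closure hb)
    have h2 : ∀ᶠ a in 𝓝 pt, dist (restrict n (T (incl pt k (g a)))) (restrict n (T e))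
        < 1 / ((j : ℝ) + 1) := by
      have hc : Continuous fun a => restrict n (T (incl pt k (g a))) :=
        (continuous_restrict n).comp (hT.comp ((continuous_incl k).comp hg))
      have h := Metric.tendsto_nhds.1 (hc.tendsto pt) (1 / ((j : ℝ) + 1)) (by positivity)
      simpa only [hgpt, hincl k (by omega)] using h
    obtain ⟨a, ⟨ha1, ha2⟩, ha3⟩ := ((h1.and h2).filter_mono nhdsWithin_le_nhds |>.and
      (eventually_mem_nhdsWithin (a := pt) (s := {pt}ᶜ))).exists
    refine ⟨incl pt k (g a), fun hmem => ha3 ?_, ha1, ha2⟩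
    have h := mem_range_incl_iff.1 hmem k (by omega)
    rw [incl_apply_of_lt _ (Nat.lt_succ_self k)] at h
    have hlast : (⟨k, Nat.lt_succ_self k⟩ : Fin (k + 1)) = Fin.last k := rfl
    simpa [g, hlast] using h
  choose x hx1 hx2 hx3 using key
  have hlim : Tendsto (fun j => restrict n (T (x j))) atTop (𝓝 (restrict n (T e))) :=
    tendsto_iff_dist_tendsto_zero.2 (squeeze_zero (fun _ => dist_nonneg) (fun j => (hx3 j).le)
      tendsto_one_div_add_atTop_nhds_zero_nat)
  have hlim' : Tendsto x atTop (𝓝 e) := by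
    have h := (hS.tendsto _).comp (((continuous_incl (pt := pt) n).tendsto _).comp hlim)
    rw [incl_restrict (mem_range_incl_iff.1 hTe), hST] at h
    refine h.congr fun j => ?_
    simp only [Function.comp_apply, incl_restrict (mem_range_incl_iff.1 (hx2 j)), hST]
  have hcl : IsClosed (⋃ j, {x j}) := isClosed_iUnion_of_disjoint_range_incl
    (fun _ => isClosed_singleton) fun j z hz hzr => hx1 j (by
      rw [mem_singleton_iff.1 hz] at hzr
      exact range_incl_mono (Nat.le_add_left j N) hzr)
  have hmem := hcl.mem_of_tendsto hlim' (Eventually.of_forall fun j => mem_iUnion.2 ⟨j, rfl⟩)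
  obtain ⟨j, hj⟩ := mem_iUnion.1 hmem
  exact hx1 j (range_incl_mono (Nat.le_add_right N j) (mem_singleton_iff.1 hj ▸ he))

end DirectLimitPower

/-! ### Separated sequences -/

theorem isClosed_range_of_separated_image {Y M : Type*} [TopologicalSpace Y] [T1Space Y]
    [PseudoMetricSpace M] {f : Y → M} (hf : Continuous f) {z : ℕ → Y} {ε : ℝ} (hε : 0 < ε)
    (hz : ∀ i j, i ≠ j → ε ≤ dist (f (z i)) (f (z j))) : IsClosed (range z) := by
  have hlf : LocallyFinite fun m => ({z m} : Set Y) := by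
    intro y
    refine ⟨f ⁻¹' Metric.ball (f y) (ε / 2), hf.continuousAt.preimage_mem_nhds
      (Metric.ball_mem_nhds _ (by positivity)), Set.Subsingleton.finite ?_⟩
    rintro i ⟨a, rfl, hi⟩ j ⟨b, rfl, hj⟩
    by_contra hij
    have h1 : dist (f (z i)) (f y) < ε / 2 := hi
    have h2 : dist (f (z j)) (f y) < ε / 2 := hj
    linarith [hz i j hij, dist_triangle_right (f (z i)) (f (z j)) (f y)]
  simpa using hlf.isClosed_iUnion fun _ => isClosed_singleton

theorem exists_separated_seq_of_mem_interior_closure {E : Type*} [NormedAddCommGroup E]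
    [NormedSpace ℝ E] (hE : ¬ FiniteDimensional ℝ E) {C O : Set E} (hO : IsOpen O) {c : E}
    (hcO : c ∈ O) (hc : c ∈ interior (closure C)) :
    ∃ ε : ℝ, 0 < ε ∧ ∃ v : ℕ → E, (∀ m, v m ∈ C ∩ O) ∧
      ∀ i j, i ≠ j → ε ≤ dist (v i) (v j) := by
  obtain ⟨R, f, hR, hfR, hf⟩ := exists_seq_norm_le_one_le_norm_sub (𝕜 := ℝ) hE
  obtain ⟨δ, hδ, hball⟩ := Metric.isOpen_iff.1 (hO.inter isOpen_interior) c ⟨hcO, hc⟩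
  have hR0 : 0 < R := by linarith
  -- The points `c + s • f m` are `s`-separated in the ball, and `C` comes within `s / 3` of each.
  set s := δ / (2 * R) with hs
  have hs0 : 0 < s := by positivity
  have hmem : ∀ m, c + s • f m ∈ O ∩ interior (closure C) := fun m => hball (by
    rw [Metric.mem_ball, dist_eq_norm, add_sub_cancel_left, norm_smul, Real.norm_of_nonneg hs0.le]
    have h1 : s * ‖f m‖ ≤ s * R := mul_le_mul_of_nonneg_left (hfR m) hs0.le
    have h2 : s * R = δ / 2 := by rw [hs]; field_simp
    linarith)
  have happrox : ∀ m, ∃ v ∈ C ∩ O, dist v (c + s • f m) < s / 3 := fun m => by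
    obtain ⟨v, ⟨hv1, hv2⟩, hvC⟩ := mem_closure_iff.1 (interior_subset (hmem m).2)
      (O ∩ Metric.ball (c + s • f m) (s / 3)) (hO.inter Metric.isOpen_ball)
      ⟨(hmem m).1, Metric.mem_ball_self (by positivity)⟩
    exact ⟨v, ⟨hvC, hv1⟩, hv2⟩
  choose v hv hvd using happrox
  refine ⟨s / 3, by positivity, v, hv, fun i j hij => ?_⟩
  have h1 : s ≤ dist (c + s • f i) (c + s • f j) := by
    rw [dist_add_left, dist_eq_norm, ← smul_sub, norm_smul, Real.norm_of_nonneg hs0.le]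
    exact le_mul_of_one_le_right hs0.le (hf hij)
  have h2 := dist_triangle4_left (v i) (c + s • f i) (v j) (c + s • f j)
  have h3 := dist_triangle4 (c + s • f i) (v i) (v j) (c + s • f j)
  rw [dist_comm (c + s • f i) (v i)] at h3
  linarith [hvd i, hvd j]

/-! ### The obstruction -/

namespace DirectLimitPower

variable {E : Type*} [NormedAddCommGroup E] [NormedSpace ℝ E]

/-- Existence of the closed set `Zₙ` of the obstruction, for one `n`. The first arguments of `p`
arise from `e` by changing the coordinate `0` to `v m`; the Baire category theorem provides the
common stage `k` of the second arguments. -/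
theorem exists_closed_range_avoiding_stage [CompleteSpace E] (hE : ¬ FiniteDimensional ℝ E)
    {p q : DirectLimitPower E 0 → DirectLimitPower E 0 → DirectLimitPower E 0}
    (hp : ∀ y, Continuous (p y)) (hq : ∀ y, Continuous (q y)) (hqp : ∀ y x, q y (p y x) = x)
    {e : DirectLimitPower E 0} (hpe : ∀ y, p y e = y) {N : ℕ} (he : e ∈ range (incl 0 N))
    (n : ℕ) {r : ℝ} (hr : 0 < r) :
    ∃ (k : ℕ) (v : ℕ → E) (w : ℕ → Fin (k + 1) → E), N ≤ k ∧ (∀ m, dist (v m) (e.1 0) < r) ∧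
      Tendsto w atTop (𝓝 (restrict k e)) ∧
      (∀ m, p (incl 0 N (Function.update (restrict N e) 0 (v m))) (incl 0 k (w m))
        ∉ range (incl 0 n)) ∧
      IsClosed (range fun m =>
        p (incl 0 N (Function.update (restrict N e) 0 (v m))) (incl 0 k (w m))) := by
  have : Nontrivial E := by
    by_contra h
    rw [not_nontrivial_iff_subsingleton] at h
    exact hE inferInstance
  have : (𝓝[≠] (0 : E)).NeBot := Module.punctured_nhds_neBot ℝ E 0
  set y : E → DirectLimitPower E 0 := fun v => incl 0 N (Function.update (restrict N e) 0 v)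
    with hy
  have hy0 : ∀ v, (y v).1 0 = v := fun v => by
    rw [hy, incl_apply_of_lt _ (Nat.succ_pos N)]
    exact Function.update_self _ _ _
  let C : ℕ → Set E := fun k =>
    {v | N ≤ k ∧ restrict k e ∈ closure {w | p (y v) (incl 0 k w) ∉ range (incl 0 n)}}
  have hC : ⋃ k, closure (C k) = univ := eq_univ_of_forall fun v => by
    obtain ⟨k, hk⟩ := exists_mem_closure_notMem_range_incl (hp (y v)) (hq (y v)) (hqp (y v)) he n
    exact mem_iUnion.2 ⟨k, subset_closure hk⟩
  obtain ⟨c, hcint, hcr⟩ := (dense_iUnion_interior_of_closed (fun k => isClosed_closure) hC)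
    |>.inter_open_nonempty (Metric.ball (e.1 0) r) Metric.isOpen_ball
      ⟨_, Metric.mem_ball_self hr⟩
  obtain ⟨k, hk⟩ := mem_iUnion.1 hcr
  obtain ⟨ε, hε, v, hv, hsep⟩ :=
    exists_separated_seq_of_mem_interior_closure hE Metric.isOpen_ball hcint hk
  have hNk : N ≤ k := (hv 0).1.1
  have hek : incl 0 k (restrict k e) = e :=
    incl_restrict (mem_range_incl_iff.1 (range_incl_mono hNk he))
  have hw : ∀ m : ℕ, ∃ w : Fin (k + 1) → E, p (y (v m)) (incl 0 k w) ∉ range (incl 0 n) ∧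
      dist ((p (y (v m)) (incl 0 k w)).1 0) (v m) < ε / 3 ∧
      dist w (restrict k e) < 1 / ((m : ℝ) + 1) := by
    intro m
    have hc : Continuous fun w => (p (y (v m)) (incl 0 k w)).1 0 :=
      (continuous_apply 0).comp ((hp _).comp (continuous_incl k))
    have h := Metric.tendsto_nhds.1 (hc.tendsto (restrict k e)) (ε / 3) (by positivity)
    rw [hek, hpe, hy0] at h
    obtain ⟨w, hw1, hw2, hw3⟩ := ((mem_closure_iff_frequently.1 (hv m).1.2).and_eventually
      (h.and (Metric.ball_mem_nhds _ (by positivity : 0 < 1 / ((m : ℝ) + 1))))).exists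
    exact ⟨w, hw1, hw2, hw3⟩
  choose w hw1 hw2 hw3 using hw
  refine ⟨k, v, w, hNk, fun m => (hv m).2, ?_, hw1, ?_⟩
  · exact tendsto_iff_dist_tendsto_zero.2 (squeeze_zero (fun _ => dist_nonneg)
      (fun j => (hw3 j).le) tendsto_one_div_add_atTop_nhds_zero_nat)
  · refine isClosed_range_of_separated_image (continuous_apply 0) (ε := ε / 3) (by positivity)
      fun i j hij => ?_
    have h3 := dist_triangle4 (v i) ((p (y (v i)) (incl 0 k (w i))).1 0)
      ((p (y (v j)) (incl 0 k (w j))).1 0) (v j)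
    rw [dist_comm (v i) ((p (y (v i)) (incl 0 k (w i))).1 0)] at h3
    change ε / 3 ≤ dist ((p (y (v i)) (incl 0 k (w i))).1 0) ((p (y (v j)) (incl 0 k (w j))).1 0)
    linarith [hw2 i, hw2 j, hsep i j hij]

/-- For an infinite-dimensional Banach space `E` there is no jointly continuous operation `p` on
`E^∞` with a right unit `e` and continuous left inverses `q y` of the maps `p y`. -/
theorem not_exists_continuous_right_unital [CompleteSpace E] (hE : ¬ FiniteDimensional ℝ E)
    {p q : DirectLimitPower E 0 → DirectLimitPower E 0 → DirectLimitPower E 0}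
    (hp : Continuous fun z : DirectLimitPower E 0 × DirectLimitPower E 0 => p z.1 z.2)
    (hq : ∀ y, Continuous (q y)) (hqp : ∀ y x, q y (p y x) = x) (e : DirectLimitPower E 0)
    (hpe : ∀ y, p y e = y) : False := by
  obtain ⟨N, he⟩ := exists_mem_range_incl e
  have hp' : ∀ y, Continuous (p y) := fun y => hp.comp (Continuous.prodMk_right y)
  -- The stage `N + n` contains `e`, so that `e ∉ Zₙ`.
  choose k v w hNk hv hw hZ hcl using fun n : ℕ => exists_closed_range_avoiding_stage hE hp' hq
    hqp hpe he (N + n) (Nat.one_div_pos_of_nat (α := ℝ) (n := n))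
  set y : E → DirectLimitPower E 0 := fun v => incl 0 N (Function.update (restrict N e) 0 v)
    with hy
  have hyc : Continuous y :=
    (continuous_incl N).comp (continuous_const.update 0 continuous_id)
  have hye : y (e.1 0) = e := by
    have : e.1 0 = restrict N e 0 := rfl
    rw [hy, this]
    simp only [Function.update_eq_self]
    exact incl_restrict (mem_range_incl_iff.1 he)
  set D := ⋃ n, range fun m => p (y (v n m)) (incl 0 (k n) (w n m)) with hD
  have hDcl : IsClosed D := isClosed_iUnion_of_disjoint_range_incl hcl fun n z hz hzr => by
    obtain ⟨m, rfl⟩ := hz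
    exact hZ n m (range_incl_mono (Nat.le_add_left n N) hzr)
  have heD : e ∉ D := fun h => by
    obtain ⟨n, m, hm⟩ := mem_iUnion.1 h
    exact hZ n m (range_incl_mono (Nat.le_add_right N n) (by rwa [← hm] at he))
  have hnhds : ∀ᶠ z in 𝓝 e ×ˢ 𝓝 e, p z.1 z.2 ∈ Dᶜ := by
    rw [← nhds_prod_eq]
    refine (hp.tendsto (e, e)).eventually (p := fun x => x ∈ Dᶜ) ?_
    simp only [hpe]
    exact hDcl.isOpen_compl.mem_nhds heD
  obtain ⟨P, hP, Q, hQ, hPQ⟩ := eventually_prod_iff.1 hnhds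
  obtain ⟨δ, hδ, hball⟩ := Metric.eventually_nhds_iff.1
    ((hyc.tendsto (e.1 0)).eventually (p := P) (hye.symm ▸ hP))
  obtain ⟨n, hn⟩ := exists_nat_one_div_lt hδ
  have hwlim : Tendsto (fun m => incl 0 (k n) (w n m)) atTop (𝓝 e) := by
    have h := ((continuous_incl (pt := (0 : E)) (k n)).tendsto _).comp (hw n)
    rwa [incl_restrict (mem_range_incl_iff.1 (range_incl_mono (hNk n) he))] at h
  obtain ⟨m, hm⟩ := (hwlim.eventually hQ).exists
  exact hPQ (hball ((hv n m).trans hn)) hm (mem_iUnion.2 ⟨n, m, rfl⟩)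

end DirectLimitPower

theorem not_finiteDimensional_lp_two : ¬ FiniteDimensional ℝ (lp (fun _ : ℕ => ℝ) 2) := by
  intro h
  let b : HilbertBasis ℕ ℝ (lp (fun _ : ℕ => ℝ) 2) := HilbertBasis.ofRepr (.refl ℝ _)
  exact not_finite_iff_infinite.2 inferInstance b.orthonormal.linearIndependent.finite

theorem isEmpty_homeomorph_of_continuous_right_unital {G : Type*} [TopologicalSpace G]
    {p q : G → G → G} (hp : Continuous fun z : G × G => p z.1 z.2) (hq : ∀ y, Continuous (q y))
    (hqp : ∀ y x, q y (p y x) = x) {e : G} (hpe : ∀ y, p y e = y) : IsEmpty (L2Infty ≃ₜ G) := by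
  refine ⟨fun h => ?_⟩
  refine DirectLimitPower.not_exists_continuous_right_unital not_finiteDimensional_lp_two
    (p := fun x y => h.symm (p (h x) (h y))) (q := fun x y => h.symm (q (h x) (h y)))
    ?_ (fun y => ?_) (fun y x => ?_) (h.symm e) (fun y => ?_)
  · exact h.symm.continuous.comp (hp.comp (h.continuous.prodMap h.continuous))
  · exact h.symm.continuous.comp ((hq _).comp h.continuous)
  · simp [hqp]
  · simp [hpe]

/-! ### Rectifiable spaces, paratopological groups and topological loops -/

theorem IsRectifiable.isEmpty_homeomorph {G : Type*} [TopologicalSpace G] (hG : IsRectifiable G) :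
    IsEmpty (L2Infty ≃ₜ G) := by
  obtain ⟨φ, e, hφ, hφe⟩ := hG
  have h1 : ∀ z, (φ z).1 = z.1 := fun z => congrFun hφ z
  have h2 : ∀ z, (φ.symm z).1 = z.1 := fun z => by
    rw [← h1 (φ.symm z), φ.apply_symm_apply]
  refine isEmpty_homeomorph_of_continuous_right_unital (p := fun y x => (φ.symm (y, x)).2)
    (q := fun y x => (φ (y, x)).2) (e := e) ?_ (fun y => ?_) (fun y x => ?_) (fun y => ?_)
  · exact continuous_snd.comp φ.symm.continuous
  · exact continuous_snd.comp (φ.continuous.comp (Continuous.prodMk_right y))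
  · have h : (y, (φ.symm (y, x)).2) = φ.symm (y, x) := Prod.ext (h2 (y, x)).symm rfl
    simp only [h, φ.apply_symm_apply]
  · simp only [← hφe y, φ.symm_apply_apply]

theorem isEmpty_homeomorph_of_continuousMul (G : Type*) [TopologicalSpace G] [Group G]
    [ContinuousMul G] : IsEmpty (L2Infty ≃ₜ G) :=
  isEmpty_homeomorph_of_continuous_right_unital (p := fun y x : G => y * x)
    (q := fun y x => y⁻¹ * x) continuous_mul (fun y => continuous_const_mul y⁻¹)
    inv_mul_cancel_left mul_one

theorem TopologicalLoop.isEmpty_homeomorph {G : Type*} [TopologicalSpace G]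
    (L : TopologicalLoop G) : IsEmpty (L2Infty ≃ₜ G) :=
  isEmpty_homeomorph_of_continuous_right_unital L.continuous_mul
    (fun y => L.continuous_ldiv.comp (Continuous.prodMk_right y)) L.ldiv_mul L.mul_one

theorem mainTheorem1 :
    (∀ (G : Type*) [TopologicalSpace G], IsRectifiable G → IsEmpty (L2Infty ≃ₜ G)) ∧
    (∀ (G : Type*) [TopologicalSpace G] [Group G] [ContinuousMul G], IsEmpty (L2Infty ≃ₜ G)) ∧
    (∀ (G : Type*) [TopologicalSpace G], TopologicalLoop G → IsEmpty (L2Infty ≃ₜ G)) ∧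
    (∀ (G : Type*) [TopologicalSpace G] [Group G] [IsTopologicalGroup G],
      IsEmpty (L2Infty ≃ₜ G)) :=
  ⟨fun _ _ hG => hG.isEmpty_homeomorph, fun G _ _ _ => isEmpty_homeomorph_of_continuousMul G,
    fun _ _ L => L.isEmpty_homeomorph, fun G _ _ _ => isEmpty_homeomorph_of_continuousMul G⟩
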